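/- Fix nonnegative integers $k,\mathfrak d,m$. There is a constant $A>0$, depending only on $k,\mathfrak d,m$, such that the following holds for all $N,M$. Let $H=\sum_{a=1}^M\lambda_aE_a$ be a low-intersection Hamiltonian on $N$ qubits: each $E_a\in\{I,X,Y,Z\}^{\otimes N}$ is a Pauli operator acting nontrivially on at most $k$ qubits, the support of each $E_a$ (the set of qubits on which it acts nontrivially) intersects the supports of at most $\mathfrak d$ other terms $E_b$, $b\neq a$, and $\lambda_a\in\mathbb R$ with $|\lambda_a|\le 1$. Let $C\subseteq[N]$ be a set of qubits with $|C|\le m$, and let $\mathcal R=(P_1,\dots,P_R)$, $R\ge 1$, be a finite family of $N$-qubit Pauli operators (for instance an enumeration of a set $\mathcal R_c$ of Pauli operators) such that $$\frac1{R}\sum_{\nu=1}^{R}P_\nu HP_\nu=H_{\mathrm{eff}}^C\otimes I+I\otimes H_{\mathrm{env}},$$ where $H_{\mathrm{eff}}^C$ acts on the qubits in $C$ and $H_{\mathrm{env}}$ acts on the qubits in $[N]\setminus C$. For $\tau\in\mathbb R$ let $$\mathcal U(\tau)=\Big(e^{-iP_1HP_1\tau'}e^{-iP_2HP_2\tau'}\cdots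 e^{-iP_RHP_R\tau'}\Big)\Big(e^{-iP_RHP_R\tau'}\cdots e^{-iP_2HP_2\tau'}e^{-iP_1HP_1\tau'}\Big),\qquad \tau'=\frac{\tau}{2R}.$$ Then for every operator $O_C$ on the qubits in $C$ with $\|O_C\|\le1$, every real $t\ge0$ and every integer $r\ge1$, with $\tau=t/r$, $$\Big\|\big(\mathcal U(\tau)^\dagger\big)^r(O_C\otimes I)\,\mathcal U(\tau)^r-e^{iH_{\mathrm{eff}}^Ct}O_Ce^{-iH_{\mathrm{eff}}^Ct}\otimes I\Big\|\le A\,\frac{t^3}{r^2},$$ where $\|\cdot\|$ is the operator norm. In particular $A$ does not depend on the system size $N$ or on the number of terms $M$ (nor on $R$, $t$, $r$). -/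

import Mathlib

open scoped Matrix.Norms.L2Operator

namespace TrotterReshaping

/-- The four one-qubit Pauli labels. -/
inductive Pauli where
  | I
  | X
  | Y
  | Z
  deriving DecidableEq

/-- The one-qubit matrix of a Pauli label. -/
def Pauli.toMatrix : Pauli → Matrix (Fin 2) (Fin 2) ℂ
  | .I => 1
  | .X => !![0, 1; 1, 0]
  | .Y => !![0, -Complex.I; Complex.I, 0]
  | .Z => !![1, 0; 0, -1]

/-- Operators on the qubits labelled by `Q`, in the computational basis `Q → Fin 2`.
They carry the operator norm induced by the Euclidean norm of the state space. -/
abbrev QubitOp (Q : Type) : Type := Matrix (Q → Fin 2) (Q → Fin 2) ℂ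

/-- An `N`-qubit Pauli string, an element of `{I, X, Y, Z}^N`. -/
abbrev PauliString (N : ℕ) : Type := Fin N → Pauli

/-- The qubits on which a Pauli string acts nontrivially. -/
def PauliString.support {N : ℕ} (P : PauliString N) : Finset (Fin N) :=
  Finset.univ.filter fun α => P α ≠ Pauli.I

/-- The `N`-qubit Pauli operator of a Pauli string: the tensor product of its one-qubit factors,
written in matrix entries. -/
noncomputable def PauliString.op {N : ℕ} (P : PauliString N) : QubitOp (Fin N) :=
  Matrix.of fun x y => ∏ α, (P α).toMatrix (x α) (y α)

/-- The data of a low-intersection Hamiltonian `∑ a, λ a • E a` on `N` qubits with `M` Pauli terms: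
every term acts nontrivially on at most `k` qubits, and its support meets the supports of at most
`d` other terms. -/
structure LowIntersectionHamiltonian (N M k d : ℕ) where
  /-- The real coefficients `λ a`. -/
  coeff : Fin M → ℝ
  /-- The Pauli terms `E a`. -/
  term : Fin M → PauliString N
  card_support_le : ∀ a, (term a).support.card ≤ k
  card_overlap_le : ∀ a,
    (Finset.univ.filter fun b =>
      b ≠ a ∧ ¬ Disjoint (term a).support (term b).support).card ≤ d

/-- The Hamiltonian as an operator. -/
noncomputable def LowIntersectionHamiltonian.op {N M k d : ℕ}
    (H : LowIntersectionHamiltonian N M k d) : QubitOp (Fin N) :=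
  ∑ a, (H.coeff a : ℂ) • (H.term a).op

/-- `A ⊗ I`: the operator on all `N` qubits that acts as `A` on the qubits in `S` and as the
identity on the remaining qubits. -/
noncomputable def extend {N : ℕ} (S : Finset (Fin N)) (A : QubitOp {α // α ∈ S}) :
    QubitOp (Fin N) :=
  (Matrix.kronecker A (1 : QubitOp {α // ¬ α ∈ S})).submatrix
    (Equiv.piEquivPiSubtypeProd (fun α => α ∈ S) (fun _ => Fin 2))
    (Equiv.piEquivPiSubtypeProd (fun α => α ∈ S) (fun _ => Fin 2))

/-- The evolution operator `exp (-i A s)`. -/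
noncomputable def evolution {Q : Type} [Fintype Q] [DecidableEq Q] (A : QubitOp Q) (s : ℝ) :
    QubitOp Q :=
  NormedSpace.exp ((-(Complex.I * (s : ℂ))) • A)

/-- The average `(1 / R) ∑ ν, P ν * H * P ν` of a Hamiltonian over `R` Pauli operators. -/
noncomputable def pauliAverage {N R : ℕ} (P : Fin R → PauliString N) (H : QubitOp (Fin N)) :
    QubitOp (Fin N) :=
  (R : ℂ)⁻¹ • ∑ ν, (P ν).op * H * (P ν).op

/-- The symmetric second-order Trotter product
`V 1 * V 2 * ⋯ * V R * (V R * ⋯ * V 2 * V 1)` with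
`V ν = exp (-i (P ν * H * P ν) τ / (2 R))`. -/
noncomputable def trotterStep {N R : ℕ} (P : Fin R → PauliString N) (H : QubitOp (Fin N))
    (τ : ℝ) : QubitOp (Fin N) :=
  (List.ofFn fun ν => evolution ((P ν).op * H * (P ν).op) (τ / (2 * R))).prod *
    (List.ofFn fun ν => evolution ((P ν).op * H * (P ν).op) (τ / (2 * R))).reverse.prod

end TrotterReshaping

/-! Everything is done in the Heisenberg picture, where locality of the observable replaces any
bound on the norm of the Hamiltonian. Each factor of the product acts on observables as an isometry,
so Taylor remainders involve only threefold nested commutators with the observable.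

Conjugation by a Pauli operator only changes signs of coefficients, so all the Hamiltonians in play,
including the average, are combinations of the same `E a` with coefficients in `[-1, 1]`. For an
observable on `C`, few terms contribute to the first commutator, and each further commutator adds at
most `d + 1` terms. Hence `norm_heisenbergGen_three_le` bounds the nested commutators independently
of `N`, `M` and `R`.

The product is a palindrome, so its expansion agrees through second order with evolution under the
averaged Hamiltonian (`orderedPairSum_of_palindrome`). One step therefore costs `O(τ ^ 3)`
(`norm_trotter_sub_heisenberg_le`). The averaged evolution decouples `C` from its complement
(`heisenberg_extend`), so the exactly evolved observable stays on `C` and the same one-step bound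
holds at every step. Summing `r` errors of size `(t / r) ^ 3` gives `t ^ 3 / r ^ 2`. -/

namespace TrotterReshaping

/-! ### Heisenberg evolution, Taylor remainders, palindromic products and error accumulation. -/

section Heisenberg

variable {𝓐 : Type*} [CStarAlgebra 𝓐]

/-- The generator `X ↦ i [H, X]` of the Heisenberg evolution under `H`. -/
noncomputable def heisenbergGen (H : 𝓐) : Module.End ℝ 𝓐 :=
  LinearMap.mulLeft ℝ (Complex.I • H) - LinearMap.mulRight ℝ (Complex.I • H)

theorem heisenbergGen_apply (H X : 𝓐) :
    heisenbergGen H X = Complex.I • H * X - X * (Complex.I • H) := rfl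

theorem heisenbergGen_add (H G : 𝓐) :
    heisenbergGen (H + G) = heisenbergGen H + heisenbergGen G := by
  ext X
  simp only [heisenbergGen_apply, LinearMap.add_apply, smul_add, add_mul, mul_add]
  abel

theorem heisenbergGen_real_smul (c : ℝ) (H : 𝓐) :
    heisenbergGen ((c : ℂ) • H) = c • heisenbergGen H := by
  ext X
  simp only [heisenbergGen_apply, LinearMap.smul_apply, smul_sub, smul_mul_assoc, mul_smul_comm,
    Complex.coe_smul, smul_comm Complex.I c]

theorem heisenbergGen_list_sum (l : List 𝓐) :
    heisenbergGen l.sum = (l.map heisenbergGen).sum := by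
  induction l with
  | nil => ext X; simp [heisenbergGen_apply]
  | cons H l ih => simp [heisenbergGen_add, ih]

/-- The Heisenberg evolution `X ↦ exp (i H s) X exp (-i H s)`. -/
noncomputable def heisenberg (H : 𝓐) (s : ℝ) : Module.End ℝ 𝓐 :=
  LinearMap.mulLeft ℝ (NormedSpace.exp ((Complex.I * s) • H)) ∘ₗ
    LinearMap.mulRight ℝ (NormedSpace.exp ((-(Complex.I * s)) • H))

theorem heisenberg_apply (H X : 𝓐) (s : ℝ) :
    heisenberg H s X = NormedSpace.exp ((Complex.I * s) • H) * X *
      NormedSpace.exp ((-(Complex.I * s)) • H) := by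
  simp [heisenberg, mul_assoc]

theorem heisenberg_zero (H X : 𝓐) : heisenberg H 0 X = X := by
  simp [heisenberg_apply, NormedSpace.exp_zero]

theorem hasDerivAt_heisenberg (H X : 𝓐) (s : ℝ) :
    HasDerivAt (fun s : ℝ => heisenberg H s X) (heisenberg H s (heisenbergGen H X)) s := by
  have e1 (s : ℝ) : (Complex.I * s) • H = s • (Complex.I • H) := by
    rw [mul_comm, mul_smul, Complex.coe_smul]
  have e2 (s : ℝ) : (-(Complex.I * s)) • H = s • (-(Complex.I • H)) := by
    rw [neg_smul, e1, smul_neg]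
  simp only [heisenberg_apply, e1, e2]
  have h1 := hasDerivAt_exp_smul_const (𝕂 := ℝ) (Complex.I • H) s
  have h2 := hasDerivAt_exp_smul_const' (𝕂 := ℝ) (-(Complex.I • H)) s
  refine ((h1.mul_const X).mul h2).congr_deriv ?_
  rw [heisenbergGen_apply]
  noncomm_ring

theorem exp_I_smul_mem_unitary {H : 𝓐} (hH : IsSelfAdjoint H) {z : ℂ} (hz : star z = -z) :
    NormedSpace.exp (z • H) ∈ unitary 𝓐 := by
  let +nondep : NormedAlgebra ℚ 𝓐 := .restrictScalars ℚ ℂ 𝓐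
  refine NormedSpace.exp_mem_unitary_of_mem_skewAdjoint ?_
  rw [skewAdjoint.mem_iff, star_smul, hz, hH.star_eq, neg_smul]

theorem norm_heisenberg {H : 𝓐} (hH : IsSelfAdjoint H) (s : ℝ) (X : 𝓐) :
    ‖heisenberg H s X‖ = ‖X‖ := by
  rw [heisenberg_apply, CStarRing.norm_mul_mem_unitary, CStarRing.norm_mem_unitary_mul] <;>
    exact exp_I_smul_mem_unitary hH (by simp)

theorem norm_le_of_deriv_le {f f' : ℝ → 𝓐} {B B' : ℝ → ℝ} (hf : ∀ x, HasDerivAt f (f' x) x)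
    (hB : ∀ x, HasDerivAt B (B' x) x) (h0 : ‖f 0‖ ≤ B 0) (h : ∀ x, 0 ≤ x → ‖f' x‖ ≤ B' x)
    {s : ℝ} (hs : 0 ≤ s) : ‖f s‖ ≤ B s :=
  image_norm_le_of_norm_deriv_right_le_deriv_boundary
    (fun x _ => (hf x).continuousAt.continuousWithinAt) (fun x _ => (hf x).hasDerivWithinAt)
    h0 hB (fun x hx => h x hx.1) (Set.right_mem_Icc.2 hs)

/-- The derivative is the evolved commutator, and evolution is isometric. In the next two lemmas the
derivative of each remainder is the remainder of one order lower at `heisenbergGen H X`. -/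
theorem heisenberg_taylor_one {H X : 𝓐} (hH : IsSelfAdjoint H) {K : ℝ}
    (hK : ‖heisenbergGen H X‖ ≤ K) {s : ℝ} (hs : 0 ≤ s) :
    ‖heisenberg H s X - X‖ ≤ s * K := by
  refine norm_le_of_deriv_le (fun x => (hasDerivAt_heisenberg H X x).sub_const X)
    (fun x => (hasDerivAt_id x).mul_const K) ?_ (fun x _ => ?_) hs
  · simp [heisenberg_zero]
  · simpa [norm_heisenberg hH] using hK

theorem heisenberg_taylor_two {H X : 𝓐} (hH : IsSelfAdjoint H) {K : ℝ}
    (hK : ‖heisenbergGen H (heisenbergGen H X)‖ ≤ K) {s : ℝ} (hs : 0 ≤ s) :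
    ‖heisenberg H s X - X - s • heisenbergGen H X‖ ≤ s ^ 2 / 2 * K := by
  refine norm_le_of_deriv_le (fun x => ((hasDerivAt_heisenberg H X x).sub_const X).sub
    ((hasDerivAt_id x).smul_const (heisenbergGen H X)))
    (fun x => ((hasDerivAt_pow 2 x).div_const 2).mul_const K) ?_ (fun x hx => ?_) hs
  · simp [heisenberg_zero]
  · simpa using heisenberg_taylor_one hH hK hx

theorem heisenberg_taylor_three {H X : 𝓐} (hH : IsSelfAdjoint H) {K : ℝ}
    (hK : ‖heisenbergGen H (heisenbergGen H (heisenbergGen H X))‖ ≤ K) {s : ℝ} (hs : 0 ≤ s) :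
    ‖heisenberg H s X - X - s • heisenbergGen H X -
      (s ^ 2 / 2) • heisenbergGen H (heisenbergGen H X)‖ ≤ s ^ 3 / 6 * K := by
  refine norm_le_of_deriv_le (fun x => (((hasDerivAt_heisenberg H X x).sub_const X).sub
    ((hasDerivAt_id x).smul_const (heisenbergGen H X))).sub
    (((hasDerivAt_pow 2 x).div_const 2).smul_const (heisenbergGen H (heisenbergGen H X))))
    (fun x => ((hasDerivAt_pow 3 x).div_const 6).mul_const K) ?_ (fun x hx => ?_) hs
  · simp [heisenberg_zero]
  · have h := heisenberg_taylor_two hH hK hx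
    convert h using 1
    · simp
    · push_cast; ring

/-- The Heisenberg evolution under the product of `exp (-i H s)` for `H` in a list. -/
noncomputable def heisenbergList : List 𝓐 → ℝ → Module.End ℝ 𝓐
  | [], _ => 1
  | H :: l, s => heisenbergList l s * heisenberg H s

theorem heisenbergList_cons (H : 𝓐) (l : List 𝓐) (s : ℝ) (X : 𝓐) :
    heisenbergList (H :: l) s X = heisenbergList l s (heisenberg H s X) := rfl

theorem norm_heisenbergList {l : List 𝓐} (hl : ∀ H ∈ l, IsSelfAdjoint H) (s : ℝ) (X : 𝓐) :
    ‖heisenbergList l s X‖ = ‖X‖ := by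
  induction l generalizing X with
  | nil => rfl
  | cons H l ih =>
    rw [heisenbergList_cons, ih fun G hG => hl G (List.mem_cons_of_mem _ hG),
      norm_heisenberg (hl H List.mem_cons_self)]

/-- Twice the second-order coefficient in the expansion of a product of exponentials. -/
def orderedPairSum {A : Type*} [Ring A] : List A → A
  | [] => 0
  | a :: l => a * a + 2 • (l.sum * a) + orderedPairSum l

theorem orderedPairSum_append {A : Type*} [Ring A] (l l' : List A) :
    orderedPairSum (l ++ l') = orderedPairSum l + 2 • (l'.sum * l.sum) + orderedPairSum l' := by
  induction l with
  | nil => simp [orderedPairSum]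
  | cons a l ih => simp only [List.cons_append, orderedPairSum, ih, List.sum_append,
      List.sum_cons]; noncomm_ring

/-- A product of entries at two distinct positions, in a given order, occurs with factor 2 in
exactly one of the two sums; each square occurs once in both. -/
theorem orderedPairSum_add_reverse {A : Type*} [Ring A] (l : List A) :
    orderedPairSum l + orderedPairSum l.reverse = 2 • (l.sum * l.sum) := by
  induction l with
  | nil => simp [orderedPairSum]
  | cons a l ih =>
    rw [List.reverse_cons, orderedPairSum_append, List.sum_reverse]
    simp only [orderedPairSum, List.sum_cons, List.sum_nil]
    calc _ = (orderedPairSum l + orderedPairSum l.reverse) +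
          2 • (a * a + l.sum * a + a * l.sum) := by noncomm_ring
      _ = _ := by rw [ih]; noncomm_ring

/-- For a palindrome the two sums coincide, so no commutator survives at second order. The real
scalars serve to cancel the 2. -/
theorem orderedPairSum_of_palindrome {A : Type*} [Ring A] [Module ℝ A] {l : List A}
    (hl : l.reverse = l) : orderedPairSum l = l.sum * l.sum := by
  have h := orderedPairSum_add_reverse l
  rw [hl, ← two_nsmul] at h
  have h' := congrArg (fun x : A => (2⁻¹ : ℝ) • x) h
  simpa only [← Nat.cast_smul_eq_nsmul ℝ, smul_smul, Nat.cast_ofNat,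
    inv_mul_cancel₀ (two_ne_zero' ℝ), one_smul] using h'

theorem heisenbergList_taylor_one {l : List 𝓐} (hl : ∀ H ∈ l, IsSelfAdjoint H) {X : 𝓐} {K : ℝ}
    (hK : ∀ H ∈ l, ‖heisenbergGen H X‖ ≤ K) {s : ℝ} (hs : 0 ≤ s) :
    ‖heisenbergList l s X - X‖ ≤ l.length * s * K := by
  induction l with
  | nil => simp [heisenbergList]
  | cons H l ih =>
    simp only [List.forall_mem_cons] at hl hK
    have h1 := ih hl.2 hK.2
    have h2 := heisenberg_taylor_one hl.1 hK.1 hs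
    rw [← norm_heisenbergList hl.2 s] at h2
    calc ‖heisenbergList (H :: l) s X - X‖
        = ‖heisenbergList l s (heisenberg H s X - X) + (heisenbergList l s X - X)‖ := by
          rw [heisenbergList_cons, map_sub]; congr 1; abel
      _ ≤ s * K + l.length * s * K := norm_add_le_of_le h2 h1
      _ = _ := by push_cast [List.length_cons]; ring

theorem heisenbergList_taylor_two {l : List 𝓐} (hl : ∀ H ∈ l, IsSelfAdjoint H) {X : 𝓐} {K : ℝ}
    (hK : ∀ H ∈ l, ∀ G ∈ l, ‖heisenbergGen H (heisenbergGen G X)‖ ≤ K) {s : ℝ} (hs : 0 ≤ s) :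
    ‖heisenbergList l s X - X - s • (l.map heisenbergGen).sum X‖ ≤
      (l.length * s) ^ 2 / 2 * K := by
  induction l with
  | nil => simp [heisenbergList]
  | cons H l ih =>
    have hK1 := hK H List.mem_cons_self H List.mem_cons_self
    have hK2 : ∀ G ∈ l, ‖heisenbergGen G (heisenbergGen H X)‖ ≤ K :=
      fun G hG => hK G (List.mem_cons_of_mem _ hG) H List.mem_cons_self
    have hK3 : ∀ H ∈ l, ∀ G ∈ l, ‖heisenbergGen H (heisenbergGen G X)‖ ≤ K :=
      fun A hA B hB => hK A (List.mem_cons_of_mem _ hA) B (List.mem_cons_of_mem _ hB)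
    simp only [List.forall_mem_cons] at hl
    have h1 := ih hl.2 hK3
    have h2 := heisenberg_taylor_two hl.1 hK1 hs
    rw [← norm_heisenbergList hl.2 s] at h2
    have h3 : ‖s • (heisenbergList l s (heisenbergGen H X) - heisenbergGen H X)‖ ≤
        s * (l.length * s * K) := by
      rw [norm_smul, Real.norm_of_nonneg hs]
      exact mul_le_mul_of_nonneg_left (heisenbergList_taylor_one hl.2 hK2 hs) hs
    calc ‖heisenbergList (H :: l) s X - X - s • ((H :: l).map heisenbergGen).sum X‖
        = ‖heisenbergList l s (heisenberg H s X - X - s • heisenbergGen H X) +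
            s • (heisenbergList l s (heisenbergGen H X) - heisenbergGen H X) +
            (heisenbergList l s X - X - s • (l.map heisenbergGen).sum X)‖ := by
          rw [heisenbergList_cons, List.map_cons, List.sum_cons, LinearMap.add_apply]
          simp only [map_sub, map_smul]
          congr 1; module
      _ ≤ s ^ 2 / 2 * K + s * (l.length * s * K) + (l.length * s) ^ 2 / 2 * K :=
          norm_add_le_of_le (norm_add_le_of_le h2 h3) h1
      _ = _ := by push_cast [List.length_cons]; ring

/-- Expand the head to third order, then apply the isometric tail to each Taylor term, expanding it
to the complementary order. With `n = l.length`, the four errors add up by `1 + 3 n ^ 2 + 3 n + n ^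
3 = (n + 1) ^ 3`. -/
theorem heisenbergList_taylor_three {l : List 𝓐} (hl : ∀ H ∈ l, IsSelfAdjoint H) {X : 𝓐} {K : ℝ}
    (hK : ∀ H ∈ l, ∀ G ∈ l, ∀ F ∈ l,
      ‖heisenbergGen H (heisenbergGen G (heisenbergGen F X))‖ ≤ K) {s : ℝ} (hs : 0 ≤ s) :
    ‖heisenbergList l s X - X - s • (l.map heisenbergGen).sum X -
      (s ^ 2 / 2) • orderedPairSum (l.map heisenbergGen) X‖ ≤ (l.length * s) ^ 3 / 6 * K := by
  induction l with
  | nil => simp [heisenbergList, orderedPairSum]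
  | cons H l ih =>
    have hm : H ∈ H :: l := List.mem_cons_self
    have hs' : ∀ {G}, G ∈ l → G ∈ H :: l := fun hG => List.mem_cons_of_mem _ hG
    have h1 := ih (fun G hG => hl G (hs' hG))
      fun A hA B hB C hC => hK A (hs' hA) B (hs' hB) C (hs' hC)
    have hK1 := hK H hm H hm H hm
    have hK2 : ∀ G ∈ l, ‖heisenbergGen G (heisenbergGen H (heisenbergGen H X))‖ ≤ K :=
      fun G hG => hK G (hs' hG) H hm H hm
    have hK3 : ∀ A ∈ l, ∀ G ∈ l, ‖heisenbergGen A (heisenbergGen G (heisenbergGen H X))‖ ≤ K :=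
      fun A hA B hB => hK A (hs' hA) B (hs' hB) H hm
    simp only [List.forall_mem_cons] at hl
    have h2 := heisenberg_taylor_three hl.1 hK1 hs
    rw [← norm_heisenbergList hl.2 s] at h2
    have h3 : ‖s • (heisenbergList l s (heisenbergGen H X) - heisenbergGen H X -
        s • (l.map heisenbergGen).sum (heisenbergGen H X))‖ ≤
        s * ((l.length * s) ^ 2 / 2 * K) := by
      rw [norm_smul, Real.norm_of_nonneg hs]
      exact mul_le_mul_of_nonneg_left (heisenbergList_taylor_two hl.2 hK3 hs) hs
    have h4 : ‖(s ^ 2 / 2) • (heisenbergList l s (heisenbergGen H (heisenbergGen H X)) -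
        heisenbergGen H (heisenbergGen H X))‖ ≤ s ^ 2 / 2 * (l.length * s * K) := by
      rw [norm_smul, Real.norm_of_nonneg (by positivity)]
      exact mul_le_mul_of_nonneg_left (heisenbergList_taylor_one hl.2 hK2 hs) (by positivity)
    calc ‖heisenbergList (H :: l) s X - X - s • ((H :: l).map heisenbergGen).sum X -
          (s ^ 2 / 2) • orderedPairSum ((H :: l).map heisenbergGen) X‖
        = ‖heisenbergList l s (heisenberg H s X - X - s • heisenbergGen H X -
              (s ^ 2 / 2) • heisenbergGen H (heisenbergGen H X)) +
            s • (heisenbergList l s (heisenbergGen H X) - heisenbergGen H X -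
              s • (l.map heisenbergGen).sum (heisenbergGen H X)) +
            (s ^ 2 / 2) • (heisenbergList l s (heisenbergGen H (heisenbergGen H X)) -
              heisenbergGen H (heisenbergGen H X)) +
            (heisenbergList l s X - X - s • (l.map heisenbergGen).sum X -
              (s ^ 2 / 2) • orderedPairSum (l.map heisenbergGen) X)‖ := by
          rw [heisenbergList_cons, List.map_cons, List.sum_cons, orderedPairSum]
          simp only [map_sub, map_smul, LinearMap.add_apply, LinearMap.smul_apply,
            Module.End.mul_apply]
          congr 1; module
      _ ≤ s ^ 3 / 6 * K + s * ((l.length * s) ^ 2 / 2 * K) + s ^ 2 / 2 * (l.length * s * K) +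
            (l.length * s) ^ 3 / 6 * K :=
          norm_add_le_of_le (norm_add_le_of_le (norm_add_le_of_le h2 h3) h4) h1
      _ = _ := by push_cast [List.length_cons]; ring

/-- A palindromic product of short evolutions agrees with the evolution under the averaged
Hamiltonian up to third order. -/
theorem norm_heisenbergList_sub_heisenberg_le {l : List 𝓐} (hl : ∀ H ∈ l, IsSelfAdjoint H)
    (hrev : l.reverse = l) {G X : 𝓐} (hG : IsSelfAdjoint G) {s t K : ℝ} (hs : 0 ≤ s)
    (ht : l.length * s = t) (hsum : (s : ℂ) • l.sum = (t : ℂ) • G)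
    (hK : ∀ A ∈ l, ∀ B ∈ l, ∀ C ∈ l,
      ‖heisenbergGen A (heisenbergGen B (heisenbergGen C X))‖ ≤ K)
    (hGK : ‖heisenbergGen G (heisenbergGen G (heisenbergGen G X))‖ ≤ K) :
    ‖heisenbergList l s X - heisenberg G t X‖ ≤ t ^ 3 * (K / 3) := by
  have ht0 : 0 ≤ t := by rw [← ht]; positivity
  have hgen : s • (l.map heisenbergGen).sum = t • heisenbergGen G := by
    rw [← heisenbergGen_list_sum, ← heisenbergGen_real_smul, hsum, heisenbergGen_real_smul]
  have hpair : (s ^ 2 / 2) • orderedPairSum (l.map heisenbergGen) =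
      (t ^ 2 / 2) • (heisenbergGen G * heisenbergGen G) := by
    rw [orderedPairSum_of_palindrome (by rw [← List.map_reverse, hrev])]
    have h := congrArg (fun L => (2⁻¹ : ℝ) • (L * L)) hgen
    simp only [smul_mul_smul_comm, smul_smul] at h
    convert h using 2 <;> ring
  have h1 := heisenbergList_taylor_three hl hK hs
  have h2 := heisenberg_taylor_three hG hGK ht0
  rw [← LinearMap.smul_apply, ← LinearMap.smul_apply, hgen, hpair, ht] at h1
  simp only [LinearMap.smul_apply, Module.End.mul_apply] at h1
  calc _ ≤ t ^ 3 / 6 * K + t ^ 3 / 6 * K := by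
        refine (congrArg norm ?_).trans_le (norm_sub_le_of_le h1 h2)
        module
    _ = _ := by ring

/-- The Heisenberg evolution under a product of unitaries `exp (-i H s)`. -/
theorem star_prod_mul_mul_prod {l : List 𝓐} (hl : ∀ H ∈ l, IsSelfAdjoint H) (s : ℝ) (X : 𝓐) :
    star (l.map fun H => NormedSpace.exp ((-(Complex.I * s)) • H)).prod * X *
      (l.map fun H => NormedSpace.exp ((-(Complex.I * s)) • H)).prod = heisenbergList l s X := by
  induction l generalizing X with
  | nil => simp [heisenbergList]
  | cons H l ih =>
    simp only [List.forall_mem_cons] at hl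
    rw [heisenbergList_cons, ← ih hl.2, heisenberg_apply, List.map_cons, List.prod_cons, star_mul,
      NormedSpace.star_exp, star_smul, hl.1.star_eq]
    have : star (-(Complex.I * (s : ℂ))) = Complex.I * s := by simp
    rw [this]
    simp only [mul_assoc]

/-- Errors of single steps add up, when the exact evolution stays in `S`. -/
theorem norm_pow_sub_pow_le {Φ Ψ : Module.End ℝ 𝓐} {S : Set 𝓐} {ε : ℝ}
    (hΦ : ∀ X ∈ S, Φ X ∈ S) (hΨ : ∀ X, ‖Ψ X‖ ≤ ‖X‖) (h : ∀ X ∈ S, ‖Ψ X - Φ X‖ ≤ ε) (r : ℕ)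
    {X : 𝓐} (hX : X ∈ S) : ‖(Ψ ^ r) X - (Φ ^ r) X‖ ≤ r * ε := by
  have hpow (r : ℕ) (Y : 𝓐) : ‖(Ψ ^ r) Y‖ ≤ ‖Y‖ := by
    induction r with
    | zero => simp
    | succ r ih => rw [pow_succ', Module.End.mul_apply]; exact (hΨ _).trans ih
  induction r generalizing X with
  | zero => simp
  | succ r ih =>
    calc ‖(Ψ ^ (r + 1)) X - (Φ ^ (r + 1)) X‖
        = ‖(Ψ ^ r) (Ψ X - Φ X) + ((Ψ ^ r) (Φ X) - (Φ ^ r) (Φ X))‖ := by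
          simp only [pow_succ, Module.End.mul_apply, map_sub]; congr 1; abel
      _ ≤ ε + r * ε := norm_add_le_of_le ((hpow r _).trans (h X hX)) (ih (hΦ X hX))
      _ = _ := by push_cast; ring

theorem star_pow_mul_mul_pow {U : 𝓐} {Ψ : Module.End ℝ 𝓐} (h : ∀ X, star U * X * U = Ψ X)
    (r : ℕ) (X : 𝓐) : star U ^ r * X * U ^ r = (Ψ ^ r) X := by
  induction r with
  | zero => simp
  | succ r ih =>
    rw [pow_succ' (star U), pow_succ U, pow_succ', Module.End.mul_apply, ← ih, ← h]
    simp only [mul_assoc]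

theorem heisenberg_pow (H : 𝓐) (s : ℝ) (r : ℕ) (X : 𝓐) :
    (heisenberg H s ^ r) X = heisenberg H (r * s) X := by
  induction r with
  | zero => simp [heisenberg_zero]
  | succ r ih =>
    rw [pow_succ', Module.End.mul_apply, ih]
    simp only [heisenberg_apply]
    have e (a b : ℂ) : NormedSpace.exp ((a + b) • H) =
        NormedSpace.exp (a • H) * NormedSpace.exp (b • H) := by
      let +nondep : NormedAlgebra ℚ 𝓐 := .restrictScalars ℚ ℂ 𝓐
      rw [add_smul]
      exact NormedSpace.exp_add_of_commute (((Commute.refl H).smul_left a).smul_right b)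
    have e1 : Complex.I * ((↑(r + 1) * s : ℝ) : ℂ) = Complex.I * s + Complex.I * ↑(r * s) := by
      push_cast; ring
    have e2 : -(Complex.I * ((↑(r + 1) * s : ℝ) : ℂ)) =
        -(Complex.I * ↑(r * s)) + -(Complex.I * s) := by
      push_cast; ring
    rw [e2, e, e1, e]
    simp only [mul_assoc]

end Heisenberg

/-! ### Nested commutators with a local observable. -/

section Locality

variable {𝓐 ι : Type*} [CStarAlgebra 𝓐]

/-- `X` commutes with all members of the family `E` outside `T`. -/
def CommutesOff (E : ι → 𝓐) (T : Finset ι) (X : 𝓐) : Prop :=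
  ∀ b ∉ T, Commute (E b) X

theorem heisenbergGen_sum_of_commutesOff [Fintype ι] {E : ι → 𝓐} {T : Finset ι} {X : 𝓐}
    (hX : CommutesOff E T X) (c : ι → ℝ) :
    heisenbergGen (∑ a, (c a : ℂ) • E a) X = ∑ a ∈ T, c a • heisenbergGen (E a) X := by
  have h : heisenbergGen (∑ a, (c a : ℂ) • E a) X = ∑ a, c a • heisenbergGen (E a) X := by
    let f : 𝓐 →+ 𝓐 := AddMonoidHom.mk' (fun H => heisenbergGen H X)
      fun H G => by rw [heisenbergGen_add, LinearMap.add_apply]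
    refine (map_sum f _ _).trans (Finset.sum_congr rfl fun a _ => ?_)
    exact congrArg (fun L => L X) (heisenbergGen_real_smul (c a) (E a))
  rw [h]
  refine (Finset.sum_subset (Finset.subset_univ T) fun b _ hb => ?_).symm
  rw [heisenbergGen_apply, smul_mul_assoc, mul_smul_comm, (hX b hb).eq, sub_self, smul_zero]

/-- An element commuting with both `E a` and `X` commutes with their commutator, so only the
neighbours of `a` are added. -/
theorem CommutesOff.heisenbergGen [DecidableEq ι] {E : ι → 𝓐} {T : Finset ι} {X : 𝓐} (hX : CommutesOff E T X)
    {nb : ι → Finset ι} (hnb : ∀ a, ∀ b ∉ nb a, Commute (E b) (E a)) (a : ι) :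
    CommutesOff E (T ∪ nb a) (heisenbergGen (E a) X) := by
  intro b hb
  rw [Finset.mem_union, not_or] at hb
  have h := (hnb a b hb.2).smul_right Complex.I
  exact (h.mul_right (hX b hb.1)).sub_right ((hX b hb.1).mul_right h)

theorem norm_heisenbergGen_le {H : 𝓐} (hH : ‖H‖ ≤ 1) (X : 𝓐) :
    ‖heisenbergGen H X‖ ≤ 2 * ‖X‖ := by
  have h : ‖Complex.I • H‖ ≤ 1 := by simpa [norm_smul] using hH
  rw [heisenbergGen_apply, two_mul]
  refine norm_sub_le_of_le ((norm_mul_le _ _).trans ?_) ((norm_mul_le _ _).trans ?_)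
  · exact mul_le_of_le_one_left (norm_nonneg _) h
  · exact mul_le_of_le_one_right (norm_nonneg _) h

/-- At most `n` terms survive in the commutator, each costing a factor 2. Applying `Φ` to the
summands separately keeps the growth at `e`: each summand enlarges `T` by a single neighbourhood,
whereas their sum would need the union of all of them. The general `Φ` allows iteration. -/
theorem norm_apply_heisenbergGen_le [Fintype ι] [DecidableEq ι] {E : ι → 𝓐}
    (hE : ∀ a, ‖E a‖ ≤ 1) {nb : ι → Finset ι}
    (hnb : ∀ a, ∀ b ∉ nb a, Commute (E b) (E a)) {e : ℕ} (he : ∀ a, (nb a).card ≤ e)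
    {c : ι → ℝ} (hc : ∀ a, |c a| ≤ 1) {Φ : Module.End ℝ 𝓐} {n : ℕ} {B : ℝ} (hB : 0 ≤ B)
    (hΦ : ∀ T : Finset ι, T.card ≤ n + e → ∀ Y, CommutesOff E T Y → ‖Φ Y‖ ≤ B * ‖Y‖)
    (T : Finset ι) (hT : T.card ≤ n) (X : 𝓐) (hX : CommutesOff E T X) :
    ‖Φ (heisenbergGen (∑ a, (c a : ℂ) • E a) X)‖ ≤ 2 * n * B * ‖X‖ := by
  rw [heisenbergGen_sum_of_commutesOff hX, map_sum]
  have hterm : ∀ a ∈ T, ‖Φ (c a • heisenbergGen (E a) X)‖ ≤ B * (2 * ‖X‖) := by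
    intro a _
    rw [map_smul, norm_smul]
    refine (mul_le_of_le_one_left (norm_nonneg _) (hc a)).trans ?_
    refine (hΦ (T ∪ nb a) ((Finset.card_union_le _ _).trans (add_le_add hT (he a))) _
      (hX.heisenbergGen hnb a)).trans ?_
    exact mul_le_mul_of_nonneg_left (norm_heisenbergGen_le (hE a) X) hB
  have hT' : (T.card : ℝ) ≤ n := by exact_mod_cast hT
  calc _ ≤ T.card * (B * (2 * ‖X‖)) := by
        simpa [nsmul_eq_mul] using norm_sum_le_of_le T hterm
    _ ≤ n * (B * (2 * ‖X‖)) := by gcongr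
    _ = _ := by ring

theorem norm_heisenbergGen_three_le [Fintype ι] [DecidableEq ι] {E : ι → 𝓐}
    (hE : ∀ a, ‖E a‖ ≤ 1) {nb : ι → Finset ι}
    (hnb : ∀ a, ∀ b ∉ nb a, Commute (E b) (E a)) {e : ℕ} (he : ∀ a, (nb a).card ≤ e)
    {c₁ c₂ c₃ : ι → ℝ} (h₁ : ∀ a, |c₁ a| ≤ 1) (h₂ : ∀ a, |c₂ a| ≤ 1) (h₃ : ∀ a, |c₃ a| ≤ 1)
    {n : ℕ} {T : Finset ι} (hT : T.card ≤ n) {X : 𝓐} (hX : CommutesOff E T X) :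
    ‖heisenbergGen (∑ a, (c₁ a : ℂ) • E a) (heisenbergGen (∑ a, (c₂ a : ℂ) • E a)
      (heisenbergGen (∑ a, (c₃ a : ℂ) • E a) X))‖ ≤
      2 * n * (2 * (n + e) * (2 * (n + e + e))) * ‖X‖ := by
  -- The outermost commutator comes first, since it sees the set already enlarged twice.
  have b1 := norm_apply_heisenbergGen_le (Φ := 1) (n := n + e + e) hE hnb he h₁ zero_le_one
    fun T _ Y _ => by simp
  have b2 := norm_apply_heisenbergGen_le (Φ := heisenbergGen (∑ a, (c₁ a : ℂ) • E a))
    (n := n + e) hE hnb he h₂ (by positivity) b1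
  have b3 := norm_apply_heisenbergGen_le (Φ := heisenbergGen (∑ a, (c₁ a : ℂ) • E a) *
    heisenbergGen (∑ a, (c₂ a : ℂ) • E a)) (n := n) hE hnb he h₃ (by positivity) b2 T hT X hX
  simpa using b3

end Locality

/-! ### Algebra of Pauli strings. -/

section PauliStrings

variable {N : ℕ}

/-- The tensor product of one-qubit operators, in matrix entries. -/
noncomputable def tensorOp {ι : Type} [Fintype ι] (f : ι → Matrix (Fin 2) (Fin 2) ℂ) : QubitOp ι :=
  Matrix.of fun x y => ∏ α, f α (x α) (y α)

theorem tensorOp_mul {ι : Type} [Fintype ι] [DecidableEq ι] (f g : ι → Matrix (Fin 2) (Fin 2) ℂ) :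
    tensorOp f * tensorOp g = tensorOp fun α => f α * g α := by
  ext x y
  simp only [tensorOp, Matrix.mul_apply, Matrix.of_apply, ← Finset.prod_mul_distrib]
  exact (Fintype.prod_sum fun α j => f α (x α) j * g α j (y α)).symm

theorem tensorOp_one {ι : Type} [Fintype ι] [DecidableEq ι] :
    tensorOp (fun _ : ι => (1 : Matrix (Fin 2) (Fin 2) ℂ)) = 1 := by
  ext x y
  simp only [tensorOp, Matrix.of_apply, Matrix.one_apply, Finset.prod_ite_zero,
    Finset.prod_const_one, Finset.mem_univ, true_imp_iff, funext_iff]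

theorem tensorOp_smul {ι : Type} [Fintype ι] (c : ι → ℂ) (f : ι → Matrix (Fin 2) (Fin 2) ℂ) :
    tensorOp (fun α => c α • f α) = (∏ α, c α) • tensorOp f := by
  ext x y
  simp [tensorOp, Finset.prod_mul_distrib]

theorem star_tensorOp {ι : Type} [Fintype ι] (f : ι → Matrix (Fin 2) (Fin 2) ℂ) :
    star (tensorOp f) = tensorOp fun α => star (f α) := by
  ext x y
  simp [tensorOp, Matrix.star_apply]

theorem PauliString.op_eq (P : PauliString N) : P.op = tensorOp fun α => (P α).toMatrix := rfl

theorem Pauli.star_toMatrix (p : Pauli) : star p.toMatrix = p.toMatrix := by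
  cases p <;> ext i j <;> fin_cases i <;> fin_cases j <;> simp [Pauli.toMatrix, Matrix.star_apply]

theorem Pauli.toMatrix_mul_self (p : Pauli) : p.toMatrix * p.toMatrix = 1 := by
  cases p <;> ext i j <;> fin_cases i <;> fin_cases j <;>
    simp [Pauli.toMatrix, Matrix.mul_apply, Fin.sum_univ_two]

/-- Two Pauli matrices commute or anticommute, and `p` squares to 1. For strings the signs multiply
over the qubits. -/
theorem Pauli.exists_conj_eq (p q : Pauli) : ∃ c : ℝ, |c| = 1 ∧
    p.toMatrix * q.toMatrix * p.toMatrix = (c : ℂ) • q.toMatrix := by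
  by_cases h : p = Pauli.I ∨ q = Pauli.I ∨ p = q
  · refine ⟨1, by simp, ?_⟩
    rcases h with rfl | rfl | rfl
    · simp [Pauli.toMatrix]
    · rw [Pauli.toMatrix, mul_one, Pauli.toMatrix_mul_self]; simp
    · rw [Pauli.toMatrix_mul_self]; simp
  · refine ⟨-1, by simp, ?_⟩
    cases p <;> cases q <;> simp at h <;> ext i j <;> fin_cases i <;> fin_cases j <;>
      simp [Pauli.toMatrix, Matrix.mul_apply, Fin.sum_univ_two]

theorem PauliString.isSelfAdjoint_op (P : PauliString N) : IsSelfAdjoint P.op := by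
  rw [IsSelfAdjoint, P.op_eq, star_tensorOp]
  simp only [Pauli.star_toMatrix]

theorem PauliString.op_mul_self (P : PauliString N) : P.op * P.op = 1 := by
  rw [P.op_eq, tensorOp_mul]
  simp only [Pauli.toMatrix_mul_self, tensorOp_one]

theorem PauliString.norm_op_le (P : PauliString N) : ‖P.op‖ ≤ 1 := by
  have h := CStarRing.norm_star_mul_self (x := P.op)
  rw [P.isSelfAdjoint_op.star_eq, P.op_mul_self, CStarRing.norm_one] at h
  nlinarith [norm_nonneg P.op]

theorem PauliString.exists_conj_eq (P Q : PauliString N) : ∃ c : ℝ, |c| = 1 ∧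
    P.op * Q.op * P.op = (c : ℂ) • Q.op := by
  choose c hc h using fun α => Pauli.exists_conj_eq (P α) (Q α)
  refine ⟨∏ α, c α, by simp [Finset.abs_prod, hc], ?_⟩
  rw [P.op_eq, Q.op_eq, tensorOp_mul, tensorOp_mul]
  simp only [h]
  rw [tensorOp_smul, Complex.ofReal_prod]

theorem PauliString.commute_op {P Q : PauliString N} (h : Disjoint P.support Q.support) :
    Commute P.op Q.op := by
  rw [Commute, SemiconjBy, P.op_eq, Q.op_eq, tensorOp_mul, tensorOp_mul]
  congr 1
  ext1 α
  have hα : P α = Pauli.I ∨ Q α = Pauli.I := by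
    by_contra! hα
    exact Finset.disjoint_left.1 h (by simpa [PauliString.support] using hα.1)
      (by simpa [PauliString.support] using hα.2)
  rcases hα with hα | hα <;> simp [hα, Pauli.toMatrix]

end PauliStrings

/-! ### Operators on a subset of the qubits. -/

section Extend

variable {N : ℕ} (S : Finset (Fin N))

/-- `A ⊗ B` for the bipartition of the qubits into `S` and its complement. -/
noncomputable def splitOp (A : QubitOp {α // α ∈ S}) (B : QubitOp {α // ¬ α ∈ S}) :
    QubitOp (Fin N) :=
  (Matrix.kroneckerMap (· * ·) A B).submatrix
    (Equiv.piEquivPiSubtypeProd (fun α => α ∈ S) (fun _ => Fin 2))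
    (Equiv.piEquivPiSubtypeProd (fun α => α ∈ S) (fun _ => Fin 2))

theorem splitOp_apply (A : QubitOp {α // α ∈ S}) (B : QubitOp {α // ¬ α ∈ S})
    (x y : Fin N → Fin 2) :
    splitOp S A B x y = A (fun α => x α) (fun α => y α) * B (fun α => x α) (fun α => y α) := rfl

theorem extend_eq_splitOp (A : QubitOp {α // α ∈ S}) : extend S A = splitOp S A 1 := rfl

theorem splitOp_mul (A A' : QubitOp {α // α ∈ S}) (B B' : QubitOp {α // ¬ α ∈ S}) :
    splitOp S A B * splitOp S A' B' = splitOp S (A * A') (B * B') := by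
  rw [splitOp, splitOp, splitOp, Matrix.submatrix_mul_equiv, ← Matrix.mul_kronecker_mul]

theorem extend_mul (A A' : QubitOp {α // α ∈ S}) :
    extend S (A * A') = extend S A * extend S A' := by
  simp only [extend_eq_splitOp, splitOp_mul, mul_one]

theorem extend_one : extend S (1 : QubitOp {α // α ∈ S}) = 1 := by
  rw [extend_eq_splitOp, splitOp,
    Matrix.kroneckerMap_one_one _ zero_mul mul_zero (one_mul 1)]
  exact Matrix.submatrix_one_equiv _

theorem extend_smul (c : ℂ) (A : QubitOp {α // α ∈ S}) : extend S (c • A) = c • extend S A := by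
  ext x y
  simp only [extend_eq_splitOp, Matrix.smul_apply, splitOp_apply, smul_mul_assoc]

/-- `A ⊗ I` as a homomorphism of star algebras. -/
noncomputable def extendHom : QubitOp {α // α ∈ S} →⋆ₐ[ℂ] QubitOp (Fin N) where
  toFun := extend S
  map_one' := extend_one S
  map_mul' := extend_mul S
  map_zero' := by simpa using extend_smul S 0 0
  map_add' A B := by
    ext x y
    simp only [extend_eq_splitOp, Matrix.add_apply, splitOp_apply, add_mul]
  commutes' c := by
    rw [Algebra.algebraMap_eq_smul_one, Algebra.algebraMap_eq_smul_one, extend_smul, extend_one]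
  map_star' A := by
    ext x y
    simp only [extend_eq_splitOp, Matrix.star_apply, splitOp_apply, star_mul', Matrix.one_apply]
    congr 1
    rw [apply_ite star, star_one, star_zero]
    exact if_congr eq_comm rfl rfl

theorem norm_extend_le (A : QubitOp {α // α ∈ S}) : ‖extend S A‖ ≤ ‖A‖ :=
  NonUnitalStarAlgHom.norm_apply_le (extendHom S) A

theorem extend_exp (A : QubitOp {α // α ∈ S}) :
    extend S (NormedSpace.exp A) = NormedSpace.exp (extend S A) := by
  have hc : Continuous (extendHom S) :=
    (extendHom S).toAlgHom.toLinearMap.continuous_of_finiteDimensional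
  let +nondep : NormedAlgebra ℚ (QubitOp {α // α ∈ S}) := .restrictScalars ℚ ℂ _
  exact NormedSpace.map_exp (extendHom S) hc A

/-- The subtypes for `α ∈ Sᶜ` and `¬ α ∈ S` differ only in the membership proof; reindexing puts
both kinds of operator in one tensor decomposition. -/
theorem exists_extend_compl_eq_splitOp (B : QubitOp {α // α ∈ Sᶜ}) :
    ∃ B' : QubitOp {α // ¬ α ∈ S}, extend Sᶜ B = splitOp S 1 B' := by
  refine ⟨Matrix.of fun x y => B (fun α => x ⟨α, Finset.mem_compl.1 α.2⟩)
    (fun α => y ⟨α, Finset.mem_compl.1 α.2⟩), ?_⟩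
  ext x y
  simp only [extend_eq_splitOp, splitOp_apply, Matrix.one_apply, Matrix.of_apply, funext_iff,
    Subtype.forall, Finset.mem_compl, not_not]
  rw [mul_comm]

theorem commute_extend_splitOp_one (A : QubitOp {α // α ∈ S}) (B : QubitOp {α // ¬ α ∈ S}) :
    Commute (extend S A) (splitOp S 1 B) := by
  rw [Commute, SemiconjBy, extend_eq_splitOp, splitOp_mul, splitOp_mul]
  simp only [mul_one, one_mul]

theorem commute_extend_extend_compl (A : QubitOp {α // α ∈ S}) (B : QubitOp {α // α ∈ Sᶜ}) :
    Commute (extend S A) (extend Sᶜ B) := by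
  obtain ⟨B', hB⟩ := exists_extend_compl_eq_splitOp S B
  rw [hB]
  exact commute_extend_splitOp_one S A B'

theorem commute_op_extend {P : PauliString N} (h : Disjoint P.support S)
    (A : QubitOp {α // α ∈ S}) : Commute P.op (extend S A) := by
  have hP : P.op = splitOp S 1 (tensorOp fun α : {α // ¬ α ∈ S} => (P α).toMatrix) := by
    have h1 : (1 : QubitOp {α // α ∈ S}) = tensorOp fun α : {α // α ∈ S} => (P α).toMatrix := by
      rw [← tensorOp_one]
      congr 1
      ext1 α
      have hα : P α = Pauli.I := by
        by_contra hα
        exact Finset.disjoint_left.1 h (by simpa [PauliString.support] using hα) α.2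
      rw [hα, Pauli.toMatrix]
    rw [h1, P.op_eq]
    ext x y
    rw [splitOp_apply]
    simp only [tensorOp, Matrix.of_apply]
    rw [← Fintype.prod_subtype_mul_prod_subtype (fun α => α ∈ S)
      fun α => (P α).toMatrix (x α) (y α)]
    congr!
  rw [hP]
  exact (commute_extend_splitOp_one S A _).symm

end Extend

/-! ### Decoupled evolution, overlap counting and the error of one step. -/

section Trotter

variable {N M k d R : ℕ}

/-- The two summands commute, so the exponential factorizes; the environment factors commute with
the observable and cancel. -/
theorem heisenberg_extend (C : Finset (Fin N)) (A : QubitOp {α // α ∈ C})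
    (B : QubitOp {α // α ∈ Cᶜ}) (O : QubitOp {α // α ∈ C}) (t : ℝ) :
    heisenberg (extend C A + extend Cᶜ B) t (extend C O) =
      extend C (evolution A (-t) * O * evolution A t) := by
  let +nondep : NormedAlgebra ℚ (QubitOp (Fin N)) := .restrictScalars ℚ ℂ _
  have hAB := commute_extend_extend_compl C A B
  have hexp (z : ℂ) : NormedSpace.exp (z • (extend C A + extend Cᶜ B)) =
      NormedSpace.exp (z • extend C A) * NormedSpace.exp (z • extend Cᶜ B) := by
    rw [smul_add]
    exact NormedSpace.exp_add_of_commute ((hAB.smul_left z).smul_right z)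
  have hcomm (z w : ℂ) : Commute (NormedSpace.exp (z • extend C A))
      (NormedSpace.exp (w • extend Cᶜ B)) :=
    (((hAB.smul_left z).smul_right w).exp_left).exp_right
  have hO (z : ℂ) : Commute (extend C O) (NormedSpace.exp (z • extend Cᶜ B)) :=
    ((commute_extend_extend_compl C O B).smul_right z).exp_right
  have hinv (z : ℂ) : NormedSpace.exp (z • extend Cᶜ B) *
      NormedSpace.exp ((-z) • extend Cᶜ B) = 1 := by
    rw [← NormedSpace.exp_add_of_commute
      (((Commute.refl (extend Cᶜ B)).smul_left z).smul_right (-z)), ← add_smul, add_neg_cancel,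
      zero_smul, NormedSpace.exp_zero]
  have hneg : -(Complex.I * ((-t : ℝ) : ℂ)) = Complex.I * t := by push_cast; ring
  rw [heisenberg_apply, evolution, evolution, extend_mul, extend_mul, extend_exp, extend_exp,
    extend_smul, extend_smul, hneg, hexp, hexp, (hcomm _ _).eq]
  generalize Complex.I * (t : ℂ) = z
  -- This order puts both environment factors next to the observable.
  rw [(hcomm (-z) (-z)).eq, ← (hcomm z z).eq]
  calc _ = NormedSpace.exp (z • extend C A) * (NormedSpace.exp (z • extend Cᶜ B) * extend C O) *
        NormedSpace.exp ((-z) • extend Cᶜ B) * NormedSpace.exp ((-z) • extend C A) := by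
        simp only [mul_assoc]
    _ = NormedSpace.exp (z • extend C A) * extend C O * (NormedSpace.exp (z • extend Cᶜ B) *
        NormedSpace.exp ((-z) • extend Cᶜ B)) * NormedSpace.exp ((-z) • extend C A) := by
        rw [← (hO z).eq]; simp only [mul_assoc]
    _ = _ := by rw [hinv, mul_one]

namespace LowIntersectionHamiltonian

variable (H : LowIntersectionHamiltonian N M k d)

/-- The terms whose supports meet the support of the term `a`. -/
def overlapping (a : Fin M) : Finset (Fin M) :=
  Finset.univ.filter fun b => ¬ Disjoint (H.term a).support (H.term b).support

/-- The terms whose supports meet `C`. -/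
def touching (C : Finset (Fin N)) : Finset (Fin M) :=
  Finset.univ.filter fun b => ¬ Disjoint (H.term b).support C

/-- The extra 1 accounts for `a` itself, which the overlap condition of the structure excludes. -/
theorem card_overlapping_le (a : Fin M) : (H.overlapping a).card ≤ d + 1 := by
  refine (Finset.card_le_card (t := insert a (Finset.univ.filter fun b =>
    b ≠ a ∧ ¬ Disjoint (H.term a).support (H.term b).support)) fun b hb => ?_).trans
    ((Finset.card_insert_le _ _).trans (Nat.add_le_add_right (H.card_overlap_le a) 1))
  by_cases h : b = a
  · simp [h]
  · simpa [overlapping, h] using hb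

theorem commute_of_notMem_overlapping (a b : Fin M) (hb : b ∉ H.overlapping a) :
    Commute (H.term b).op (H.term a).op :=
  (PauliString.commute_op (by simpa [overlapping] using hb)).symm

/-- All terms acting on a given qubit overlap any one of them, so there are at most `d + 1` per
qubit of `C`. -/
theorem card_touching_le {C : Finset (Fin N)} {m : ℕ} (hC : C.card ≤ m) :
    (H.touching C).card ≤ m * (d + 1) := by
  have hsub : H.touching C ⊆
      C.biUnion fun α => Finset.univ.filter fun b => α ∈ (H.term b).support := by
    intro b hb
    obtain ⟨α, h1, h2⟩ := Finset.not_disjoint_iff.1 (Finset.mem_filter.1 hb).2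
    exact Finset.mem_biUnion.2 ⟨α, h2, by simpa using h1⟩
  refine (Finset.card_le_card hsub).trans
    ((Finset.card_biUnion_le_card_mul C _ (d + 1) fun α _ => ?_).trans
      (Nat.mul_le_mul_right _ hC))
  rcases Finset.eq_empty_or_nonempty (Finset.univ.filter fun b => α ∈ (H.term b).support)
    with h | ⟨a, ha⟩
  · simp [h]
  · refine (Finset.card_le_card fun b hb => ?_).trans (H.card_overlapping_le a)
    simp only [Finset.mem_filter, Finset.mem_univ, true_and] at ha hb
    simpa [overlapping] using Finset.not_disjoint_iff.2 ⟨α, ha, hb⟩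

theorem commutesOff_extend (C : Finset (Fin N)) (O : QubitOp {α // α ∈ C}) :
    CommutesOff (fun a => (H.term a).op) (H.touching C) (extend C O) :=
  fun _ hb => commute_op_extend C (by simpa [touching] using hb) O

theorem isSelfAdjoint_op : IsSelfAdjoint H.op := by
  refine isSelfAdjoint_sum _ fun a _ => ?_
  exact IsSelfAdjoint.smul (Complex.conj_ofReal _) (H.term a).isSelfAdjoint_op

theorem exists_conj_eq (h : ∀ a, |H.coeff a| ≤ 1) (P : PauliString N) :
    ∃ c : Fin M → ℝ, (∀ a, |c a| ≤ 1) ∧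
      P.op * H.op * P.op = ∑ a, (c a : ℂ) • (H.term a).op := by
  choose c hc hP using fun a => P.exists_conj_eq (H.term a)
  refine ⟨fun a => H.coeff a * c a, fun a => by rw [abs_mul, hc, mul_one]; exact h a, ?_⟩
  rw [LowIntersectionHamiltonian.op, Finset.mul_sum, Finset.sum_mul]
  refine Finset.sum_congr rfl fun a _ => ?_
  rw [mul_smul_comm, smul_mul_assoc, hP, smul_smul, Complex.ofReal_mul]

/-- Averaging preserves the coefficient bound, so the exact evolution obeys the same commutator
estimate as the factors. -/
theorem exists_pauliAverage_eq (h : ∀ a, |H.coeff a| ≤ 1) (P : Fin R → PauliString N) :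
    ∃ c : Fin M → ℝ, (∀ a, |c a| ≤ 1) ∧
      pauliAverage P H.op = ∑ a, (c a : ℂ) • (H.term a).op := by
  choose c hc hP using fun ν => H.exists_conj_eq h (P ν)
  refine ⟨fun a => (R : ℝ)⁻¹ * ∑ ν, c ν a, fun a => ?_, ?_⟩
  · rw [abs_mul, abs_of_nonneg (by positivity)]
    have h1 : |∑ ν, c ν a| ≤ R := by
      refine (Finset.abs_sum_le_sum_abs _ _).trans
        ((Finset.sum_le_sum fun ν _ => hc ν a).trans (by simp))
    exact (mul_le_mul_of_nonneg_left h1 (by positivity)).trans (inv_mul_le_one (a := (R : ℝ)))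
  · rw [pauliAverage]
    simp only [hP]
    rw [Finset.sum_comm, Finset.smul_sum]
    refine Finset.sum_congr rfl fun a _ => ?_
    rw [← Finset.sum_smul, smul_smul]
    push_cast
    rfl

end LowIntersectionHamiltonian

theorem isSelfAdjoint_conj {H : QubitOp (Fin N)} (hH : IsSelfAdjoint H) (P : PauliString N) :
    IsSelfAdjoint (P.op * H * P.op) := by
  have h := hH.conjugate P.op
  rwa [P.isSelfAdjoint_op.star_eq] at h

theorem isSelfAdjoint_pauliAverage {H : QubitOp (Fin N)} (hH : IsSelfAdjoint H)
    (P : Fin R → PauliString N) : IsSelfAdjoint (pauliAverage P H) :=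
  IsSelfAdjoint.smul (by simp [IsSelfAdjoint])
    (isSelfAdjoint_sum _ fun ν _ => isSelfAdjoint_conj hH (P ν))

/-- The Hamiltonians of the factors of `trotterStep`, in order. -/
noncomputable def trotterList (P : Fin R → PauliString N) (H : QubitOp (Fin N)) :
    List (QubitOp (Fin N)) :=
  (List.ofFn fun ν => (P ν).op * H * (P ν).op) ++
    (List.ofFn fun ν => (P ν).op * H * (P ν).op).reverse

theorem mem_trotterList {P : Fin R → PauliString N} {H A : QubitOp (Fin N)} :
    A ∈ trotterList P H ↔ ∃ ν, (P ν).op * H * (P ν).op = A := by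
  simp [trotterList, List.mem_ofFn]

theorem isSelfAdjoint_of_mem_trotterList {P : Fin R → PauliString N} {H A : QubitOp (Fin N)}
    (hH : IsSelfAdjoint H) (hA : A ∈ trotterList P H) : IsSelfAdjoint A := by
  obtain ⟨ν, rfl⟩ := mem_trotterList.1 hA
  exact isSelfAdjoint_conj hH (P ν)

theorem trotterStep_eq (P : Fin R → PauliString N) (H : QubitOp (Fin N)) (τ : ℝ) :
    trotterStep P H τ = ((trotterList P H).map fun A =>
      NormedSpace.exp ((-(Complex.I * ((τ / (2 * R) : ℝ) : ℂ))) • A)).prod := by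
  rw [trotterStep, trotterList, List.map_append, List.prod_append, List.map_reverse,
    List.map_ofFn]
  rfl

/-- The constant is the nested commutator bound with `n = m * (d + 1)` and `e = d + 1`; the third is
two Taylor remainders of one sixth each. -/
theorem norm_trotter_sub_heisenberg_le (H : LowIntersectionHamiltonian N M k d)
    (h : ∀ a, |H.coeff a| ≤ 1) {C : Finset (Fin N)} {m : ℕ} (hC : C.card ≤ m)
    (P : Fin R → PauliString N) (hR : 0 < R) (O : QubitOp {α // α ∈ C}) (hO : ‖extend C O‖ ≤ 1)
    {τ : ℝ} (hτ : 0 ≤ τ) :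
    ‖heisenbergList (trotterList P H.op) (τ / (2 * R)) (extend C O) -
      heisenberg (pauliAverage P H.op) τ (extend C O)‖ ≤
      τ ^ 3 * ((2 * (m * (d + 1) : ℕ) * (2 * ((m * (d + 1) : ℕ) + (d + 1 : ℕ)) *
        (2 * ((m * (d + 1) : ℕ) + (d + 1 : ℕ) + (d + 1 : ℕ)))) : ℝ) / 3) := by
  have hR' : (R : ℝ) ≠ 0 := by exact_mod_cast hR.ne'
  have hRc : (R : ℂ) ≠ 0 := by exact_mod_cast hR.ne'
  have hthree {c₁ c₂ c₃ : Fin M → ℝ} (h₁ : ∀ a, |c₁ a| ≤ 1) (h₂ : ∀ a, |c₂ a| ≤ 1)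
      (h₃ : ∀ a, |c₃ a| ≤ 1) :=
    (norm_heisenbergGen_three_le (fun a => (H.term a).norm_op_le) H.commute_of_notMem_overlapping
      H.card_overlapping_le h₁ h₂ h₃ (H.card_touching_le hC) (H.commutesOff_extend C O)).trans
      (mul_le_of_le_one_right (by positivity) hO)
  refine norm_heisenbergList_sub_heisenberg_le
    (fun A => isSelfAdjoint_of_mem_trotterList H.isSelfAdjoint_op) ?_
    (isSelfAdjoint_pauliAverage H.isSelfAdjoint_op P) (by positivity) ?_ ?_ ?_ ?_
  · simp [trotterList]
  · simp only [trotterList, List.length_append, List.length_reverse, List.length_ofFn]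
    push_cast
    field_simp
    ring
  -- Each conjugate occurs twice in the list, which cancels the 2 in `τ / (2 * R)`.
  · simp only [trotterList, List.sum_append, List.sum_reverse, List.sum_ofFn, pauliAverage]
    rw [← two_smul ℂ, smul_smul, smul_smul]
    congr 1
    push_cast
    field_simp
  · intro A₁ hA₁ A₂ hA₂ A₃ hA₃
    obtain ⟨ν₁, rfl⟩ := mem_trotterList.1 hA₁
    obtain ⟨ν₂, rfl⟩ := mem_trotterList.1 hA₂
    obtain ⟨ν₃, rfl⟩ := mem_trotterList.1 hA₃
    obtain ⟨c₁, h₁, e₁⟩ := H.exists_conj_eq h (P ν₁)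
    obtain ⟨c₂, h₂, e₂⟩ := H.exists_conj_eq h (P ν₂)
    obtain ⟨c₃, h₃, e₃⟩ := H.exists_conj_eq h (P ν₃)
    rw [e₁, e₂, e₃]
    exact hthree h₁ h₂ h₃
  · obtain ⟨c, hc, e⟩ := H.exists_pauliAverage_eq h P
    rw [e]
    exact hthree hc hc hc

end Trotter

end TrotterReshaping

/-! ### The main theorem. -/

open TrotterReshaping in
theorem mainTheorem5 (k d m : ℕ) :
    ∃ A : ℝ, 0 < A ∧
      ∀ (N M : ℕ) (H : TrotterReshaping.LowIntersectionHamiltonian N M k d),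
        (∀ a, |H.coeff a| ≤ 1) →
      ∀ C : Finset (Fin N), C.card ≤ m →
      ∀ (R : ℕ) (P : Fin R → TrotterReshaping.PauliString N), 0 < R →
      ∀ (Heff : TrotterReshaping.QubitOp {α // α ∈ C})
        (Henv : TrotterReshaping.QubitOp {α // α ∈ Cᶜ}),
        TrotterReshaping.pauliAverage P H.op =
          TrotterReshaping.extend C Heff + TrotterReshaping.extend Cᶜ Henv →
      ∀ O : TrotterReshaping.QubitOp {α // α ∈ C}, ‖O‖ ≤ 1 →
      ∀ (t : ℝ) (r : ℕ), 0 ≤ t → 0 < r →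
        ‖(star (TrotterReshaping.trotterStep P H.op (t / r))) ^ r *
              TrotterReshaping.extend C O *
              (TrotterReshaping.trotterStep P H.op (t / r)) ^ r -
            TrotterReshaping.extend C
              (TrotterReshaping.evolution Heff (-t) * O *
                TrotterReshaping.evolution Heff t)‖ ≤
          A * (t ^ 3 / (r : ℝ) ^ 2) := by
  set K : ℝ := (2 * (m * (d + 1) : ℕ) * (2 * ((m * (d + 1) : ℕ) + (d + 1 : ℕ)) *
    (2 * ((m * (d + 1) : ℕ) + (d + 1 : ℕ) + (d + 1 : ℕ)))) : ℝ) / 3 with hK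
  have hK0 : 0 ≤ K := by positivity
  -- `K` vanishes when `m = 0`, hence the added 1.
  refine ⟨K + 1, by positivity, ?_⟩
  intro N M H hcoeff C hC R P hR Heff Henv havg O hO t r ht hr
  have hr' : (r : ℝ) ≠ 0 := by exact_mod_cast hr.ne'
  have hτ : 0 ≤ t / r := by positivity
  have hself := isSelfAdjoint_pauliAverage H.isSelfAdjoint_op P
  have hlist : ∀ A ∈ trotterList P H.op, IsSelfAdjoint A :=
    fun A => isSelfAdjoint_of_mem_trotterList H.isSelfAdjoint_op
  -- The unit ball of observables on `C`: the decoupling hypothesis makes it invariant under the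
  -- exact step, and the one-step bound is uniform on it.
  let S : Set (QubitOp (Fin N)) := {X | (∃ O', extend C O' = X) ∧ ‖X‖ ≤ 1}
  have hsum := norm_pow_sub_pow_le (S := S) (ε := (t / r) ^ 3 * K)
    (Φ := heisenberg (pauliAverage P H.op) (t / r))
    (Ψ := heisenbergList (trotterList P H.op) (t / r / (2 * R)))
    (by
      rintro _ ⟨⟨O', rfl⟩, hX⟩
      refine ⟨⟨evolution Heff (-(t / r)) * O' * evolution Heff (t / r), ?_⟩,
        (norm_heisenberg hself _ _).trans_le hX⟩
      rw [havg, heisenberg_extend])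
    (fun X => (norm_heisenbergList hlist _ X).le)
    (by
      rintro _ ⟨⟨O', rfl⟩, hX⟩
      exact norm_trotter_sub_heisenberg_le H hcoeff hC P hR O' hX hτ)
    r ⟨⟨O, rfl⟩, (norm_extend_le C O).trans hO⟩
  rw [heisenberg_pow, mul_div_cancel₀ t hr', havg, heisenberg_extend,
    ← star_pow_mul_mul_pow (fun X => star_prod_mul_mul_prod hlist _ X), ← trotterStep_eq] at hsum
  refine hsum.trans ?_
  calc r * ((t / r) ^ 3 * K) = K * (t ^ 3 / (r : ℝ) ^ 2) := by field_simp
    _ ≤ (K + 1) * (t ^ 3 / (r : ℝ) ^ 2) := by gcongr; linarith
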